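/- Let $d\ge 1$ and let $\psi:\mathbb{R}^d\to\mathbb{R}$ be bounded, continuous and (symmetric) positive definite. Let $k(x,y)=\psi(x-y)$, let $\mathcal{H}_k$ be the reproducing kernel Hilbert space of $k$, and let $\mu_k(P)=\int_{\mathbb{R}^d}k(\cdot,x)\,dP(x)\in\mathcal{H}_k$ (a Bochner integral) be the mean embedding of a Borel probability measure $P$ on $\mathbb{R}^d$. Assume that $k$ is characteristic, i.e. $P\mapsto\mu_k(P)$ is injective on the Borel probability measures on $\mathbb{R}^d$. Let $\Lambda_\psi$ denote the finite non-negative Borel measure on $\mathbb{R}^d$ with $$\psi(x)=\frac{1}{(2\pi)^{d/2}}\int_{\mathbb{R}^d}e^{-i\langle x,w\rangle}\,d\Lambda_\psi(w)\qquad(x\in\mathbb{R}^d).$$ Let $\mathcal{P}$ be the set of probability measures on $\mathbb{R}^d$ that have a $C^\infty$ density with respect to Lebesgue measure. Then there exist constants $c_\psi>0$ and $\epsilon_\psi>0$ such that for every $a\in\mathbb{R}^d$ with $\|a\|_2^2\le\epsilon_\psi$ $$c_\psi\le\min_{\|e\|_2=1}\frac{2}{(2\pi)^{d/2}}\int_{\mathbb{R}^d}e^{-\|w\|_2^2}\langle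 e,w\rangle^2\cos(\langle a,w\rangle)\,d\Lambda_\psi(w),\qquad(*)$$ and, for any positive constants $c_\psi,\epsilon_\psi$ with the property $(*)$ and every integer $n\ge 1/\epsilon_\psi$, $$\inf_{\hat\theta_n}\ \sup_{P\in\mathcal{P}}\ P^n\left\{\|\hat\theta_n-\mu_k(P)\|_{\mathcal{H}_k}\ge\frac12\sqrt{\frac{c_\psi}{2n}}\right\}\ge\frac14,$$ where the infimum is over all estimators $\hat\theta_n$, i.e. maps from samples $(X_1,\dots,X_n)\in(\mathbb{R}^d)^n$ to $\mathcal{H}_k$ (with $P^n$ read as the outer measure if the event is not measurable). -/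

import Mathlib

open MeasureTheory
open scoped ENNReal ContDiff RealInnerProductSpace

/-- A real function `ψ` on `ℝ^d` is positive definite: it is symmetric and all the quadratic forms
`∑ i, ∑ j, c i * c j * ψ (x i - x j)` are non-negative. -/
def IsPositiveDefinite {d : ℕ} (ψ : EuclideanSpace ℝ (Fin d) → ℝ) : Prop :=
  (∀ x, ψ (-x) = ψ x) ∧
    ∀ (m : ℕ) (x : Fin m → EuclideanSpace ℝ (Fin d)) (c : Fin m → ℝ),
      0 ≤ ∑ i, ∑ j, c i * c j * ψ (x i - x j)

/-- `H` is the reproducing kernel Hilbert space of the scalar kernel `k`. (In Mathlib the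
reproducing kernel is operator valued; on the scalar field it is determined by its value at `1`.) -/
def IsRKHSOfKernel {X : Type*} (H : Type*) [NormedAddCommGroup H] [InnerProductSpace ℝ H]
    [CompleteSpace H] [RKHS ℝ H X ℝ] (k : X → X → ℝ) : Prop :=
  ∀ x y : X, RKHS.kernel H x y 1 = k x y

/-- The kernel mean embedding `μ_k(P) = ∫ k(·, x) dP(x)`, a Bochner integral in the reproducing
kernel Hilbert space `H`; `RKHS.kerFun H x 1` is the element `k(·, x)` of `H`. -/
noncomputable def kernelMean {X : Type*} [MeasurableSpace X] (H : Type*) [NormedAddCommGroup H]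
    [InnerProductSpace ℝ H] [CompleteSpace H] [RKHS ℝ H X ℝ] (P : Measure X) : H :=
  ∫ x, RKHS.kerFun H x (1 : ℝ) ∂P

/-- The reproducing kernel of `H` is characteristic: the mean embedding is injective on the set of
all Borel probability measures. -/
def IsCharacteristicRKHS {X : Type*} [MeasurableSpace X] (H : Type*) [NormedAddCommGroup H]
    [InnerProductSpace ℝ H] [CompleteSpace H] [RKHS ℝ H X ℝ] : Prop :=
  Set.InjOn (fun P : Measure X => kernelMean H P) {P | IsProbabilityMeasure P}

/-- `Λ` is the finite non-negative Borel measure on `ℝ^d` whose Fourier transform is `ψ`. There is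
at most one such measure, since finite measures are determined by their Fourier transforms. -/
def IsBochnerMeasure {d : ℕ} (ψ : EuclideanSpace ℝ (Fin d) → ℝ)
    (Λ : Measure (EuclideanSpace ℝ (Fin d))) : Prop :=
  IsFiniteMeasure Λ ∧ ∀ x : EuclideanSpace ℝ (Fin d),
    (ψ x : ℂ) = (((2 * Real.pi) ^ (-((d : ℝ) / 2)) : ℝ) : ℂ) *
      ∫ w, Complex.exp (-Complex.I * ((⟪x, w⟫ : ℝ) : ℂ)) ∂Λ

/-- `c` and `ε` are positive constants such that, for every `a` with `‖a‖² ≤ ε`,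
`c ≤ min_{‖e‖ = 1} 2 (2π)^{-d/2} ∫ exp (-v ‖w‖²) ⟨e, w⟩² cos ⟨a, w⟩ dΛ(w)`,
where `Λ` is the measure whose Fourier transform is `ψ`. -/
def IsCurvatureConstants {d : ℕ} (ψ : EuclideanSpace ℝ (Fin d) → ℝ) (v c ε : ℝ) : Prop :=
  0 < c ∧ 0 < ε ∧ ∃ Λ : Measure (EuclideanSpace ℝ (Fin d)), IsBochnerMeasure ψ Λ ∧
    ∀ a : EuclideanSpace ℝ (Fin d), ‖a‖ ^ 2 ≤ ε →
      ∀ e : EuclideanSpace ℝ (Fin d), ‖e‖ = 1 →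
        c ≤ 2 * (2 * Real.pi) ^ (-((d : ℝ) / 2)) *
          ∫ w, Real.exp (-v * ‖w‖ ^ 2) * ⟪e, w⟫ ^ 2 * Real.cos ⟪a, w⟫ ∂Λ

/-- The probability measures on `ℝ^d` which have an infinitely differentiable density with respect
to Lebesgue measure. -/
def smoothDensityMeasures (d : ℕ) : Set (Measure (EuclideanSpace ℝ (Fin d))) :=
  {P | IsProbabilityMeasure P ∧ ∃ p : EuclideanSpace ℝ (Fin d) → ℝ,
    ContDiff ℝ ∞ p ∧ (∀ x, 0 ≤ p x) ∧ P = volume.withDensity fun x => ENNReal.ofReal (p x)}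

/-- The minimax probability `inf_θ sup_{P ∈ Ps} P^n {‖θ(X₁, …, X_n) - μ_k(P)‖_H ≥ s}`. The infimum
is over all maps `θ` from samples to `H` (for a non-measurable event, `Measure.pi` gives the outer
measure), hence it is at most the infimum over the measurable ones. -/
noncomputable def minimaxProbability {X : Type*} [MeasurableSpace X] (H : Type*)
    [NormedAddCommGroup H] [InnerProductSpace ℝ H] [CompleteSpace H] [RKHS ℝ H X ℝ]
    (Ps : Set (Measure X)) (n : ℕ) (s : ℝ) : ℝ≥0∞ :=
  ⨅ θ : (Fin n → X) → H, ⨆ P ∈ Ps,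
    Measure.pi (fun _ : Fin n => P) {x | s ≤ ‖θ x - kernelMean H P‖}

/-! The lower bound is Le Cam's two-point method for the unit Gaussians N(0,I) and N(a,I) with ‖a‖²
= 1/n, both of which have smooth densities. Their n-fold products have Hellinger affinity
exp(-n‖a‖²/8) = exp(-1/8) ≥ 7/8, so no test separates them with total error below 1/2
(`half_le_pi_gaussianShift_add`), and an estimator that is precise under both laws would be such a
test (`quarter_le_minimaxProbability`).

Their mean embeddings are nevertheless far apart. With C = (2π)^(-d/2), Fubini gives the squared
distance 2C ∫ exp(-‖w‖²)(1 - cos⟨a,w⟩) dΛ, and Taylor's formula for the cosine along the segment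
from 0 to a turns (*) into the bound c‖a‖²/2 = c/(2n) (`le_integral_exp_mul_one_sub_cos`).

Constants with (*) exist because Λ charges the complement of every hyperplane: otherwise ψ(e) = ψ(0)
for some e ≠ 0, and the Dirac masses at e and 0 would have the same embedding. Compactness of the
sphere makes the bound uniform. Λ itself comes from Bochner's theorem, proved by Gaussian damping,
Fourier inversion and Lévy's continuity theorem. -/

/-! ### Unit Gaussians and their translates. -/

section Gaussian

variable {E : Type*} [NormedAddCommGroup E] [InnerProductSpace ℝ E]

/-- The density of the Gaussian law with mean `a` and identity covariance. -/
noncomputable def gaussianShiftPDF (a x : E) : ℝ :=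
  (2 * Real.pi) ^ (-((Module.finrank ℝ E : ℝ) / 2)) * Real.exp (-‖x - a‖ ^ 2 / 2)

lemma gaussianShiftPDF_nonneg (a x : E) : 0 ≤ gaussianShiftPDF a x := by
  unfold gaussianShiftPDF; positivity

lemma contDiff_gaussianShiftPDF (a : E) : ContDiff ℝ ∞ (gaussianShiftPDF a) := by
  unfold gaussianShiftPDF
  refine contDiff_const.mul (Real.contDiff_exp.comp (ContDiff.div_const (ContDiff.neg ?_) _))
  exact (contDiff_norm_sq ℝ).comp (contDiff_id.sub contDiff_const)

lemma continuous_gaussianShiftPDF (a : E) : Continuous (gaussianShiftPDF a) :=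
  (contDiff_gaussianShiftPDF a).continuous

variable [FiniteDimensional ℝ E] [MeasurableSpace E] [BorelSpace E]

/-- The Gaussian law with mean `a` and identity covariance. -/
noncomputable def gaussianShift (a : E) : Measure E :=
  volume.withDensity fun x => ENNReal.ofReal (gaussianShiftPDF a x)

lemma integrable_exp_neg_mul_norm_sq {b : ℝ} (hb : 0 < b) :
    Integrable fun x : E => Real.exp (-b * ‖x‖ ^ 2) := by
  have := GaussianFourier.integrable_cexp_neg_mul_sq_norm_add (b := (b : ℂ)) (by simpa) 0 (0 : E)
  refine this.norm.congr (ae_of_all _ fun x => ?_)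
  simp [Complex.norm_exp, ← Complex.ofReal_pow]

lemma integral_gaussianShift (a : E) (f : E → ℂ) :
    ∫ x, f x ∂gaussianShift a = ∫ x, (gaussianShiftPDF a x : ℂ) * f x := by
  rw [gaussianShift, integral_withDensity_eq_integral_toReal_smul
    (by have := continuous_gaussianShiftPDF a; fun_prop) (by simp)]
  simp [gaussianShiftPDF_nonneg]

lemma integral_gaussianShift_zero_cexp (c : ℂ) (w : E) :
    ∫ x, Complex.exp (c * (⟪w, x⟫ : ℝ)) ∂gaussianShift (0 : E) =
      Complex.exp (c ^ 2 * ‖w‖ ^ 2 / 2) := by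
  have h := GaussianFourier.integral_cexp_neg_mul_sq_norm_add
    (b := (1 / 2 : ℂ)) (by norm_num) c w
  have h2 : ((2 * Real.pi : ℝ) : ℂ) ≠ 0 := by exact_mod_cast (by positivity : (2 * Real.pi : ℝ) ≠ 0)
  rw [integral_gaussianShift]
  calc _ = ∫ x : E, (((2 * Real.pi : ℝ) : ℂ) ^ (-((Module.finrank ℝ E : ℂ) / 2))) *
        Complex.exp (-(1 / 2) * ‖x‖ ^ 2 + c * (⟪w, x⟫ : ℝ)) := by
        refine integral_congr_ae (ae_of_all _ fun x => ?_)
        simp only [gaussianShiftPDF, sub_zero]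
        rw [Complex.ofReal_mul, Complex.ofReal_cpow (by positivity), mul_assoc,
          Complex.ofReal_exp, ← Complex.exp_add]
        push_cast
        congr 2
        ring
    _ = _ := by
        rw [integral_const_mul, h, ← mul_assoc]
        have : (Real.pi / (1 / 2) : ℂ) = ((2 * Real.pi : ℝ) : ℂ) := by push_cast; ring
        rw [this, ← Complex.cpow_add _ _ h2]
        simp only [neg_add_cancel, Complex.cpow_zero, one_mul]
        congr 1
        ring

instance isProbabilityMeasure_gaussianShift_zero : IsProbabilityMeasure (gaussianShift (0 : E)) := by
  have h : Integrable (gaussianShiftPDF (0 : E)) := by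
    refine ((integrable_exp_neg_mul_norm_sq (E := E) one_half_pos).const_mul
      ((2 * Real.pi) ^ (-((Module.finrank ℝ E : ℝ) / 2)))).congr (ae_of_all _ fun x => ?_)
    simp only [gaussianShiftPDF, sub_zero]
    ring_nf
  have : IsFiniteMeasure (gaussianShift (0 : E)) := isFiniteMeasure_withDensity_ofReal h.2
  have h1 := integral_gaussianShift_zero_cexp (0 : ℂ) (0 : E)
  simp at h1
  refine ⟨?_⟩
  rw [← ENNReal.toReal_eq_one_iff]
  exact_mod_cast h1

lemma gaussianShift_eq_map (a : E) :
    gaussianShift a = (gaussianShift (0 : E)).map (fun x => x + a) := by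
  ext s hs
  rw [Measure.map_apply (by fun_prop) hs, gaussianShift, gaussianShift, withDensity_apply _ hs,
    withDensity_apply _ (hs.preimage (by fun_prop)),
    ← (measurePreserving_add_right volume a).setLIntegral_comp_preimage_emb
      (MeasurableEquiv.addRight a).measurableEmbedding]
  simp [gaussianShiftPDF]

instance isProbabilityMeasure_gaussianShift (a : E) : IsProbabilityMeasure (gaussianShift a) := by
  rw [gaussianShift_eq_map]
  exact Measure.isProbabilityMeasure_map (by fun_prop)

lemma charFun_gaussianShift (a t : E) :
    charFun (gaussianShift a) t = Complex.exp (⟪a, t⟫ * Complex.I - ‖t‖ ^ 2 / 2) := by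
  rw [gaussianShift_eq_map, charFun_map_add_const, charFun_apply]
  have := integral_gaussianShift_zero_cexp Complex.I t
  simp_rw [real_inner_comm t, mul_comm _ Complex.I]
  rw [this, ← Complex.exp_add]
  simp only [Complex.I_sq]
  congr 1
  ring

lemma gaussianShift_eq_withDensity (a : E) :
    gaussianShift a = (gaussianShift (0 : E)).withDensity fun x =>
      ENNReal.ofReal (Real.exp (⟪a, x⟫ - ‖a‖ ^ 2 / 2)) := by
  have h0 := continuous_gaussianShiftPDF (0 : E)
  rw [gaussianShift, gaussianShift, ← withDensity_mul _ (by fun_prop) (by fun_prop)]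
  congr 1
  ext x
  simp only [Pi.mul_apply]
  rw [← ENNReal.ofReal_mul (gaussianShiftPDF_nonneg _ _)]
  simp only [gaussianShiftPDF, mul_assoc, ← Real.exp_add]
  rw [norm_sub_sq_real, real_inner_comm]
  congr 3
  simp
  ring

lemma integral_exp_mul_inner_gaussianShift_zero (c : ℝ) (a : E) :
    ∫ x, Real.exp (c * ⟪a, x⟫) ∂gaussianShift (0 : E) = Real.exp (c ^ 2 * ‖a‖ ^ 2 / 2) := by
  have := integral_gaussianShift_zero_cexp (c : ℂ) a
  have h2 : ∀ x : E, Complex.exp ((c : ℂ) * (⟪a, x⟫ : ℝ)) = ((Real.exp (c * ⟪a, x⟫) : ℝ) : ℂ) := by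
    intro x; push_cast; rfl
  simp_rw [h2] at this
  rw [integral_complex_ofReal] at this
  exact_mod_cast this

/-- A non-integrable function has integral 0 by convention, whereas this integral is positive. -/
lemma integrable_exp_mul_inner_gaussianShift_zero (c : ℝ) (a : E) :
    Integrable (fun x => Real.exp (c * ⟪a, x⟫)) (gaussianShift (0 : E)) := by
  by_contra h
  have := integral_exp_mul_inner_gaussianShift_zero c a
  rw [integral_undef h] at this
  exact (Real.exp_pos _).ne this

end Gaussian

/-! ### Hellinger affinity and testing error. -/

section TwoPoint

lemma pi_withDensity {ι X : Type*} [Fintype ι] [MeasurableSpace X] (μ : Measure X)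
    [IsProbabilityMeasure μ] {f : X → ℝ} (hf : Integrable f μ)
    (hf0 : ∀ x, 0 ≤ f x) [IsProbabilityMeasure (μ.withDensity fun x => ENNReal.ofReal (f x))] :
    Measure.pi (fun _ : ι => μ.withDensity fun x => ENNReal.ofReal (f x)) =
      (Measure.pi fun _ : ι => μ).withDensity fun x => ENNReal.ofReal (∏ i, f (x i)) := by
  apply Measure.pi_eq
  intro s hs
  have hm : MeasurableSet (Set.univ.pi s) := MeasurableSet.univ_pi hs
  have hint : Integrable (fun x : ι → X => ∏ i, f (x i)) (Measure.pi fun _ : ι => μ) :=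
    Integrable.fintype_prod (f := fun (_ : ι) (x : X) => f x) fun _ => hf
  rw [withDensity_apply _ hm, ← ofReal_integral_eq_lintegral_ofReal hint.integrableOn
    (ae_of_all _ fun x => Finset.prod_nonneg fun i _ => hf0 _), Measure.restrict_pi_pi,
    integral_fintype_prod_eq_prod (μ := fun i => μ.restrict (s i)) (fun (_ : ι) x => f x),
    ENNReal.ofReal_prod_of_nonneg fun i _ => integral_nonneg hf0]
  refine Finset.prod_congr rfl fun i _ => ?_
  rw [withDensity_apply _ (hs i), ofReal_integral_eq_lintegral_ofReal hf.integrableOn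
    (ae_of_all _ hf0)]

/-- Weighted AM-GM: √L = √(min · max) ≤ 7/8 · min + 2/7 · max for the min and max of 1 and L; then
max = 1 + L - min, and 7/8 - 2/7 = 33/56. Linearity in min and 1 + L replaces Cauchy-Schwarz:
affinity 7/8 yields ∫ min(1, L) ≥ 17/33 > 1/2. -/
lemma sqrt_le_min_add_max {L : ℝ} (hL : 0 ≤ L) :
    Real.sqrt L ≤ 33 / 56 * min 1 L + 2 / 7 * (1 + L) := by
  have h1 := Real.sq_sqrt hL
  have h0 := Real.sqrt_nonneg L
  rcases min_cases 1 L with ⟨h, _⟩ | ⟨h, _⟩ <;> rw [h]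
  · nlinarith [sq_nonneg (Real.sqrt L - 7 / 4)]
  · nlinarith [sq_nonneg (Real.sqrt L - 4 / 7)]

/-- Two probability measures with Hellinger affinity at least `7/8` cannot be tested with total
error less than `1/2`. -/
lemma half_le_measure_add_withDensity {Y : Type*} [MeasurableSpace Y] (Q : Measure Y)
    [IsProbabilityMeasure Q] {L : Y → ℝ} (hL0 : ∀ y, 0 ≤ L y) (hLi : Integrable L Q)
    (hL1 : ∫ y, L y ∂Q = 1) (haff : 7 / 8 ≤ ∫ y, Real.sqrt (L y) ∂Q)
    {A B : Set Y} (hAB : A ∪ B = Set.univ) :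
    1 / 2 ≤ Q A + (Q.withDensity fun y => ENNReal.ofReal (L y)) B := by
  set R := Q.withDensity fun y => ENNReal.ofReal (L y) with hR
  have hRfin : IsFiniteMeasure R := isFiniteMeasure_withDensity_ofReal hLi.2
  have hmin : Integrable (fun y => min 1 (L y)) Q := (integrable_const 1).inf hLi
  have hsum : Integrable (fun y => 1 + L y) Q := (integrable_const 1).add hLi
  have hrhs : Integrable (fun y => 33 / 56 * min 1 (L y) + 2 / 7 * (1 + L y)) Q :=
    (hmin.const_mul _).add (hsum.const_mul _)
  have h1 : 7 / 8 ≤ ∫ y, (33 / 56 * min 1 (L y) + 2 / 7 * (1 + L y)) ∂Q :=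
    haff.trans (integral_mono_of_nonneg (ae_of_all _ fun y => Real.sqrt_nonneg _) hrhs
      (ae_of_all _ fun y => sqrt_le_min_add_max (hL0 y)))
  rw [integral_add (hmin.const_mul _) (hsum.const_mul _),
    integral_const_mul, integral_const_mul, integral_add (integrable_const _) hLi, hL1] at h1
  simp at h1
  -- The sets come from arbitrary estimators and need not be measurable; measurable hulls keep their
  -- outer measures and still cover the space.
  set S := toMeasurable Q A
  set T := toMeasurable R B
  have hS : MeasurableSet S := measurableSet_toMeasurable _ _
  have hT : MeasurableSet T := measurableSet_toMeasurable _ _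
  have hST : Sᶜ ⊆ T := by
    intro x hx
    have : x ∈ A ∪ B := hAB ▸ Set.mem_univ x
    rcases this with h | h
    · exact absurd (subset_toMeasurable _ _ h) hx
    · exact subset_toMeasurable _ _ h
  have h2 : ∫ y, min 1 (L y) ∂Q ≤ Q.real S + ∫ y in Sᶜ, L y ∂Q := by
    rw [← integral_add_compl hS hmin]
    gcongr
    · calc _ ≤ ∫ y in S, (1 : ℝ) ∂Q := integral_mono hmin.integrableOn
            (integrable_const _) fun y => min_le_left _ _
        _ = _ := by simp
    · exact hmin.integrableOn
    · exact hLi.integrableOn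
    · exact hS.compl.nullMeasurableSet
    · exact min_le_right _ _
  have h3 : ENNReal.ofReal (1 / 2) ≤ ENNReal.ofReal (Q.real S + ∫ y in Sᶜ, L y ∂Q) :=
    ENNReal.ofReal_le_ofReal (by linarith)
  rw [ENNReal.ofReal_add (by positivity) (integral_nonneg hL0),
    ofReal_integral_eq_lintegral_ofReal hLi.integrableOn (ae_of_all _ hL0),
    ← withDensity_apply _ hS.compl, ofReal_measureReal] at h3
  calc (1 / 2 : ℝ≥0∞) = ENNReal.ofReal (1 / 2) := by
        rw [ENNReal.ofReal_div_of_pos (by norm_num)]; simp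
    _ ≤ Q S + R Sᶜ := h3
    _ ≤ Q S + R T := by gcongr
    _ = Q A + R B := by rw [measure_toMeasurable, measure_toMeasurable]

variable {E : Type*} [NormedAddCommGroup E] [InnerProductSpace ℝ E] [FiniteDimensional ℝ E]
  [MeasurableSpace E] [BorelSpace E]

lemma half_le_pi_gaussianShift_add {n : ℕ} {a : E} (ha : n * ‖a‖ ^ 2 = 1) {A B : Set (Fin n → E)}
    (hAB : A ∪ B = Set.univ) :
    1 / 2 ≤ Measure.pi (fun _ : Fin n => gaussianShift (0 : E)) A +
      Measure.pi (fun _ : Fin n => gaussianShift a) B := by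
  have e1 : ∀ x : E, Real.exp (⟪a, x⟫ - ‖a‖ ^ 2 / 2) =
      Real.exp (-(‖a‖ ^ 2 / 2)) * Real.exp (1 * ⟪a, x⟫) := by
    intro x; rw [← Real.exp_add]; congr 1; ring
  have e2 : ∀ x : E, Real.sqrt (Real.exp (⟪a, x⟫ - ‖a‖ ^ 2 / 2)) =
      Real.exp (-(‖a‖ ^ 2 / 4)) * Real.exp (1 / 2 * ⟪a, x⟫) := by
    intro x; rw [← Real.exp_half, ← Real.exp_add]; congr 1; ring
  have hint : Integrable (fun x => Real.exp (⟪a, x⟫ - ‖a‖ ^ 2 / 2)) (gaussianShift (0 : E)) := by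
    simp_rw [e1]
    exact (integrable_exp_mul_inner_gaussianShift_zero 1 a).const_mul _
  have hprob : IsProbabilityMeasure ((gaussianShift (0 : E)).withDensity fun x =>
      ENNReal.ofReal (Real.exp (⟪a, x⟫ - ‖a‖ ^ 2 / 2))) := by
    rw [← gaussianShift_eq_withDensity]; infer_instance
  rw [gaussianShift_eq_withDensity a, pi_withDensity _ hint
    (fun x => (Real.exp_pos _).le)]
  refine half_le_measure_add_withDensity _
    (fun y => Finset.prod_nonneg fun i _ => (Real.exp_pos _).le)
    (Integrable.fintype_prod
      (f := fun (_ : Fin n) (x : E) => Real.exp (⟪a, x⟫ - ‖a‖ ^ 2 / 2)) fun _ => hint) ?_ ?_ hAB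
  · rw [integral_fintype_prod_eq_pow (fun x : E => Real.exp (⟪a, x⟫ - ‖a‖ ^ 2 / 2))]
    simp_rw [e1]
    rw [integral_const_mul, integral_exp_mul_inner_gaussianShift_zero, ← Real.exp_add]
    ring_nf
    simp
  · have : ∀ y : Fin n → E, Real.sqrt (∏ i, Real.exp (⟪a, y i⟫ - ‖a‖ ^ 2 / 2)) =
        ∏ i, Real.sqrt (Real.exp (⟪a, y i⟫ - ‖a‖ ^ 2 / 2)) := by
      intro y
      rw [Real.sqrt_eq_iff_mul_self_eq (Finset.prod_nonneg fun i _ => (Real.exp_pos _).le)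
        (Finset.prod_nonneg fun i _ => Real.sqrt_nonneg _), ← Finset.prod_mul_distrib]
      exact Finset.prod_congr rfl fun i _ => (Real.mul_self_sqrt (Real.exp_pos _).le).symm
    simp_rw [this]
    rw [integral_fintype_prod_eq_pow (fun x : E => Real.sqrt (Real.exp (⟪a, x⟫ - ‖a‖ ^ 2 / 2)))]
    simp_rw [e2]
    rw [integral_const_mul, integral_exp_mul_inner_gaussianShift_zero, ← Real.exp_add,
      Fintype.card_fin, ← Real.exp_nat_mul]
    -- Each coordinate contributes affinity exp(-‖a‖²/8); the product is exp(-1/8) ≥ 1 - 1/8, the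
    -- source of 7/8.
    have : (n : ℝ) * (-(‖a‖ ^ 2 / 4) + (1 / 2) ^ 2 * ‖a‖ ^ 2 / 2) = -(1 / 8) := by
      linear_combination (-1 / 8 : ℝ) * ha
    rw [this]
    linarith [Real.add_one_le_exp (-(1 / 8 : ℝ))]

end TwoPoint

/-! ### Translation-invariant kernels and inner products of mean embeddings. -/

section Kernel

lemma inner_kerFun_one {X H : Type*} [NormedAddCommGroup H] [InnerProductSpace ℝ H]
    [CompleteSpace H] [RKHS ℝ H X ℝ] {k : X → X → ℝ} (hH : IsRKHSOfKernel H k) (x y : X) :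
    ⟪RKHS.kerFun H y (1 : ℝ), RKHS.kerFun H x (1 : ℝ)⟫ = k x y := by
  rw [← RKHS.kernel_inner, hH]
  simp

variable {E : Type*} [NormedAddCommGroup E]
  {H : Type*} [NormedAddCommGroup H] [InnerProductSpace ℝ H] [CompleteSpace H] [RKHS ℝ H E ℝ]
  {ψ : E → ℝ}

lemma kernel_neg (hH : IsRKHSOfKernel H fun x y => ψ (x - y)) (x : E) : ψ (-x) = ψ x := by
  have h := real_inner_comm (RKHS.kerFun H (0 : E) (1 : ℝ)) (RKHS.kerFun H x (1 : ℝ))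
  rw [inner_kerFun_one hH, inner_kerFun_one hH, zero_sub, sub_zero] at h
  exact h

lemma norm_kerFun_sub_sq (hH : IsRKHSOfKernel H fun x y => ψ (x - y)) (x y : E) :
    ‖RKHS.kerFun H x (1 : ℝ) - RKHS.kerFun H y (1 : ℝ)‖ ^ 2 = 2 * ψ 0 - 2 * ψ (x - y) := by
  rw [norm_sub_sq_real, ← real_inner_self_eq_norm_sq, ← real_inner_self_eq_norm_sq,
    inner_kerFun_one hH, inner_kerFun_one hH, inner_kerFun_one hH, ← kernel_neg hH (y - x)]
  simp only [sub_self, neg_sub]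
  ring

lemma norm_kerFun_sq (hH : IsRKHSOfKernel H fun x y => ψ (x - y)) (x : E) :
    ‖RKHS.kerFun H x (1 : ℝ)‖ ^ 2 = ψ 0 := by
  rw [← real_inner_self_eq_norm_sq, inner_kerFun_one hH, sub_self]

lemma norm_kerFun_eq_sqrt (hH : IsRKHSOfKernel H fun x y => ψ (x - y)) (x : E) :
    ‖RKHS.kerFun H x (1 : ℝ)‖ = Real.sqrt (ψ 0) := by
  rw [← norm_kerFun_sq hH x, Real.sqrt_sq (norm_nonneg _)]

lemma abs_kernel_le (hH : IsRKHSOfKernel H fun x y => ψ (x - y)) (x : E) : |ψ x| ≤ ψ 0 := by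
  have h := abs_real_inner_le_norm (RKHS.kerFun H (0 : E) (1 : ℝ)) (RKHS.kerFun H x (1 : ℝ))
  rw [inner_kerFun_one hH, sub_zero, norm_kerFun_eq_sqrt hH, norm_kerFun_eq_sqrt hH] at h
  rwa [Real.mul_self_sqrt] at h
  rw [← norm_kerFun_sq hH 0]
  positivity

lemma continuous_kerFun (hH : IsRKHSOfKernel H fun x y => ψ (x - y)) (hψ : Continuous ψ) :
    Continuous fun x : E => RKHS.kerFun H x (1 : ℝ) := by
  rw [continuous_iff_continuousAt]
  intro x
  rw [ContinuousAt, tendsto_iff_norm_sub_tendsto_zero]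
  have h1 : ∀ y : E, ‖RKHS.kerFun H y (1 : ℝ) - RKHS.kerFun H x (1 : ℝ)‖ =
      Real.sqrt (2 * ψ 0 - 2 * ψ (y - x)) := fun y => by
    rw [← norm_kerFun_sub_sq hH, Real.sqrt_sq (norm_nonneg _)]
  simp_rw [h1]
  have h2 : Continuous fun y => Real.sqrt (2 * ψ 0 - 2 * ψ (y - x)) := by fun_prop
  simpa using h2.tendsto x

variable [InnerProductSpace ℝ E] [FiniteDimensional ℝ E] [MeasurableSpace E] [BorelSpace E]

lemma integrable_smul_kerFun (hH : IsRKHSOfKernel H fun x y => ψ (x - y)) (hψ : Continuous ψ)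
    {μ : Measure E} {f : E → ℝ} (hf : Integrable f μ) :
    Integrable (fun x => f x • RKHS.kerFun H x (1 : ℝ)) μ :=
  hf.smul_bdd (Real.sqrt (ψ 0)) (continuous_kerFun hH hψ).aestronglyMeasurable
    (ae_of_all _ fun x => (norm_kerFun_eq_sqrt hH x).le)

lemma integrable_prod_mul_kernel (hH : IsRKHSOfKernel H fun x y => ψ (x - y))
    (hψ : Continuous ψ) {μ ν : Measure E} [SFinite μ] [SFinite ν] {f g : E → ℝ}
    (hf : Integrable f μ) (hg : Integrable g ν) :
    Integrable (fun p : E × E => f p.1 * g p.2 * ψ (p.1 - p.2)) (μ.prod ν) :=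
  (hf.mul_prod hg).mul_bdd (c := ψ 0) (by fun_prop) (ae_of_all _ fun _ => abs_kernel_le hH _)

lemma inner_integral_smul_kerFun (hH : IsRKHSOfKernel H fun x y => ψ (x - y))
    (hψ : Continuous ψ) {μ ν : Measure E} [SFinite μ] [SFinite ν] {f g : E → ℝ}
    (hf : Integrable f μ) (hg : Integrable g ν) :
    ⟪∫ x, f x • RKHS.kerFun H x (1 : ℝ) ∂μ, ∫ y, g y • RKHS.kerFun H y (1 : ℝ) ∂ν⟫ =
      ∫ p : E × E, f p.1 * g p.2 * ψ (p.1 - p.2) ∂μ.prod ν := by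
  rw [integral_prod _ (integrable_prod_mul_kernel hH hψ hf hg), real_inner_comm,
    ← integral_inner (integrable_smul_kerFun hH hψ hf)]
  refine integral_congr_ae (ae_of_all _ fun x => ?_)
  simp only
  rw [real_inner_comm, ← integral_inner (integrable_smul_kerFun hH hψ hg)]
  refine integral_congr_ae (ae_of_all _ fun y => ?_)
  simp only
  rw [real_inner_comm, real_inner_smul_left, real_inner_smul_right, inner_kerFun_one hH]
  ring

lemma inner_kernelMean (hH : IsRKHSOfKernel H fun x y => ψ (x - y))
    (hψ : Continuous ψ) (P Q : Measure E) [IsFiniteMeasure P] [IsFiniteMeasure Q] :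
    ⟪kernelMean H P, kernelMean H Q⟫ = ∫ x, ∫ y, ψ (x - y) ∂Q ∂P := by
  have := inner_integral_smul_kerFun hH hψ (integrable_const (1 : ℝ) : Integrable _ P)
    (integrable_const (1 : ℝ) : Integrable _ Q)
  rw [integral_prod _ (integrable_prod_mul_kernel hH hψ (integrable_const (1 : ℝ))
    (integrable_const (1 : ℝ)))] at this
  simpa [kernelMean] using this

/-- The character of x - y splits into one factor in x and one in y, so two applications of Fubini
turn the double integral of ψ into characteristic functions. -/
lemma ofReal_inner_kernelMean (hH : IsRKHSOfKernel H fun x y => ψ (x - y))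
    (hψ : Continuous ψ) (P Q Λ : Measure E) [IsFiniteMeasure P] [IsFiniteMeasure Q]
    [IsFiniteMeasure Λ] {C : ℝ}
    (hΛ : ∀ x, (ψ x : ℂ) = C * ∫ w, Complex.exp (-Complex.I * ((⟪x, w⟫ : ℝ) : ℂ)) ∂Λ) :
    ((⟪kernelMean H P, kernelMean H Q⟫ : ℝ) : ℂ) =
      C * ∫ w, charFun P (-w) * charFun Q w ∂Λ := by
  have hbd : ∀ r : ℝ, ‖Complex.exp (r * Complex.I)‖ ≤ 1 := fun r =>
    (Complex.norm_exp_ofReal_mul_I r).le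
  rw [inner_kernelMean hH hψ, ← integral_complex_ofReal]
  have h1 : ∀ x y w : E, Complex.exp (-Complex.I * ((⟪x - y, w⟫ : ℝ) : ℂ)) =
      Complex.exp ((⟪x, -w⟫ : ℝ) * Complex.I) * Complex.exp ((⟪y, w⟫ : ℝ) * Complex.I) := by
    intro x y w
    rw [← Complex.exp_add, inner_sub_left, inner_neg_right]
    congr 1
    push_cast
    ring
  have h2 : ∀ x, ((∫ y, ψ (x - y) ∂Q : ℝ) : ℂ) =
      C * ∫ w, Complex.exp ((⟪x, -w⟫ : ℝ) * Complex.I) * charFun Q w ∂Λ := by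
    intro x
    rw [← integral_complex_ofReal]
    simp_rw [hΛ, h1]
    rw [integral_const_mul, integral_integral_swap]
    · simp_rw [integral_const_mul, charFun_apply]
    · refine (integrable_const (1 : ℝ)).mono' (by fun_prop) (ae_of_all _ fun p => ?_)
      simp only [Function.uncurry, norm_mul]
      exact mul_le_one₀ (hbd _) (norm_nonneg _) (hbd _)
  simp_rw [h2]
  rw [integral_const_mul, integral_integral_swap]
  · simp_rw [integral_mul_const, ← charFun_apply]
  · refine (integrable_const (Q.real Set.univ)).mono' ?_ (ae_of_all _ fun p => ?_)
    · refine AEStronglyMeasurable.mul (by fun_prop) ?_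
      exact ((stronglyMeasurable_charFun (μ := Q)).comp_measurable
        measurable_snd).aestronglyMeasurable
    · simp only [Function.uncurry, norm_mul]
      calc _ ≤ 1 * Q.real Set.univ := mul_le_mul (hbd _) (norm_charFun_le _) (norm_nonneg _) zero_le_one
        _ = _ := one_mul _

end Kernel

/-! ### Bochner's theorem. -/

section Bochner

open Filter Topology
open scoped FourierTransform

variable {E : Type*} [NormedAddCommGroup E] [InnerProductSpace ℝ E] [FiniteDimensional ℝ E]
  [MeasurableSpace E] [BorelSpace E]

/-- **Lévy's continuity theorem**: a continuous pointwise limit of characteristic functions is a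
characteristic function. -/
lemma exists_charFun_eq_of_tendsto {μ : ℕ → Measure E} [∀ n, IsProbabilityMeasure (μ n)]
    {φ : E → ℂ} (hφ : ContinuousAt φ 0)
    (h : ∀ t, Tendsto (fun n => charFun (μ n) t) atTop (𝓝 (φ t))) :
    ∃ ν : Measure E, IsProbabilityMeasure ν ∧ ∀ t, charFun ν t = φ t := by
  have htight := isTightMeasureSet_of_tendsto_charFun hφ h
  let p : ℕ → ProbabilityMeasure E := fun n => ⟨μ n, inferInstance⟩
  have hcomp : IsCompact (closure (Set.range p)) := by
    refine isCompact_closure_of_isTightMeasureSet (htight.subset ?_)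
    rintro _ ⟨_, ⟨n, rfl⟩, rfl⟩
    exact ⟨n, rfl⟩
  -- An ultrafilter finer than `atTop` supplies the limit law by compactness, without extracting a
  -- subsequence.
  let U : Ultrafilter ℕ := Ultrafilter.of atTop
  have hU : (U : Filter ℕ) ≤ atTop := Ultrafilter.of_le _
  obtain ⟨ν, -, hν⟩ := hcomp.ultrafilter_le_nhds (U.map p)
    (by rw [Ultrafilter.coe_map, le_principal_iff, mem_map]
        exact Filter.mem_of_superset univ_mem fun n _ => subset_closure ⟨n, rfl⟩)
  have hν' : Tendsto p U (𝓝 ν) := hν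
  refine ⟨ν, inferInstance, fun t => ?_⟩
  rw [ProbabilityMeasure.tendsto_iff_forall_integral_rclike_tendsto ℂ] at hν'
  have h1 := hν' (BoundedContinuousFunction.innerProbChar t)
  simp_rw [← charFun_eq_integral_innerProbChar] at h1
  exact tendsto_nhds_unique h1 ((h t).mono_left hU)

/-- A continuous integrable function with non-negative Fourier transform has integrable Fourier
transform. -/
lemma integrable_fourier_of_nonneg {Φ : E → ℂ} (hc : Continuous Φ) (hi : Integrable Φ)
    {F : E → ℝ} (hF0 : ∀ w, 0 ≤ F w) (hF : ∀ w, 𝓕 Φ w = F w) : Integrable F := by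
  have hFc : Continuous F := by
    have h1 : Continuous (𝓕 Φ) := VectorFourier.fourierIntegral_continuous
      Real.continuous_fourierChar continuous_inner hi
    have h2 : F = fun w => (𝓕 Φ w).re := by ext w; simp [hF]
    rw [h2]; exact Complex.continuous_re.comp h1
  -- Narrowing Gaussian averages of Φ at 0 tend to Φ 0. Moving the Fourier transform onto the
  -- Gaussian rewrites them as integrals of F with weights increasing to 1, and Fatou's lemma then
  -- bounds ∫ F.
  have hlim := Real.tendsto_integral_gaussian_smul' hi (v := 0) hc.continuousAt
  have hswap : ∀ c : ℝ, 0 < c →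
      ∫ w : E, ((Real.pi * c : ℂ) ^ (Module.finrank ℝ E / 2 : ℂ) *
        Complex.exp (-Real.pi ^ 2 * c * ‖0 - w‖ ^ 2)) • Φ w =
      ((∫ w, Real.exp (-c⁻¹ * ‖w‖ ^ 2) * F w : ℝ) : ℂ) := by
    intro c hc'
    have J : Integrable (fun w : E => Complex.exp (-(c⁻¹ : ℝ) * ‖w‖ ^ 2)) := by
      simpa using GaussianFourier.integrable_cexp_neg_mul_sq_norm_add (V := E)
        (b := ((c⁻¹ : ℝ) : ℂ)) (by simpa) 0 0
    have key := VectorFourier.integral_fourierIntegral_smul_eq_flip (L := innerₗ E)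
      Real.continuous_fourierChar continuous_inner J hi
    rw [← integral_complex_ofReal]
    have e1 : ∀ w, VectorFourier.fourierIntegral Real.fourierChar volume (innerₗ E).flip Φ w =
        F w := by
      intro w; rw [flip_innerₗ, ← hF]; rfl
    simp_rw [e1] at key
    have e2 : ∀ w, VectorFourier.fourierIntegral Real.fourierChar volume (innerₗ E)
        (fun w : E => Complex.exp (-(c⁻¹ : ℝ) * ‖w‖ ^ 2)) w =
        (Real.pi * c : ℂ) ^ (Module.finrank ℝ E / 2 : ℂ) *
        Complex.exp (-Real.pi ^ 2 * c * ‖0 - w‖ ^ 2) := by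
      intro w
      have := fourier_gaussian_innerProductSpace (V := E) (b := ((c⁻¹ : ℝ) : ℂ)) (by simpa) w
      refine Eq.trans ?_ (this.trans ?_)
      · rfl
      · simp only [zero_sub, norm_neg]
        congr 2
        · simp
        · push_cast; field_simp
    simp_rw [e2] at key
    rw [key]
    refine integral_congr_ae (ae_of_all _ fun w => ?_)
    simp
  have hlim' : Tendsto (fun n : ℕ => ((∫ w, Real.exp (-(n : ℝ)⁻¹ * ‖w‖ ^ 2) * F w : ℝ) : ℂ))
      atTop (𝓝 (Φ 0)) := by
    refine (hlim.comp tendsto_natCast_atTop_atTop).congr' ?_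
    filter_upwards [eventually_gt_atTop 0] with n hn
    exact hswap n (by exact_mod_cast hn)
  have hlim'' : Tendsto (fun n : ℕ => ∫⁻ w, ENNReal.ofReal (Real.exp (-(n : ℝ)⁻¹ * ‖w‖ ^ 2) * F w))
      atTop (𝓝 (ENNReal.ofReal (Φ 0).re)) := by
    have h1 := (ENNReal.continuous_ofReal.comp Complex.continuous_re).tendsto (Φ 0) |>.comp hlim'
    refine h1.congr' ?_
    filter_upwards [eventually_gt_atTop 0] with n hn
    simp only [Function.comp_apply, Complex.ofReal_re]
    refine ofReal_integral_eq_lintegral_ofReal ?_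
      (ae_of_all _ fun w => mul_nonneg (Real.exp_pos _).le (hF0 w))
    refine (integrable_exp_neg_mul_norm_sq (E := E) (b := (n : ℝ)⁻¹) (by positivity)).mul_bdd
      (c := ∫ x, ‖Φ x‖) hFc.aestronglyMeasurable (ae_of_all _ fun w => ?_)
    calc ‖F w‖ = ‖𝓕 Φ w‖ := by rw [hF, Complex.norm_real]
      _ ≤ _ := VectorFourier.norm_fourierIntegral_le_integral_norm _ _ _ _ _
  refine ⟨hFc.aestronglyMeasurable, ?_⟩
  rw [hasFiniteIntegral_iff_ofReal (ae_of_all _ hF0)]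
  have hpt : ∀ w, liminf (fun n : ℕ => ENNReal.ofReal (Real.exp (-(n : ℝ)⁻¹ * ‖w‖ ^ 2) * F w))
      atTop = ENNReal.ofReal (F w) := by
    intro w
    apply Tendsto.liminf_eq
    refine (ENNReal.continuous_ofReal.tendsto _).comp ?_
    have h1 : Continuous fun r : ℝ => Real.exp (-r * ‖w‖ ^ 2) * F w := by fun_prop
    have h2 := (h1.tendsto 0).comp (tendsto_inv_atTop_nhds_zero_nat (𝕜 := ℝ))
    simpa [Function.comp_def] using h2
  calc ∫⁻ w, ENNReal.ofReal (F w) = ∫⁻ w, liminf (fun n : ℕ =>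
          ENNReal.ofReal (Real.exp (-(n : ℝ)⁻¹ * ‖w‖ ^ 2) * F w)) atTop := by simp_rw [hpt]
    _ ≤ liminf (fun n : ℕ => ∫⁻ w, ENNReal.ofReal (Real.exp (-(n : ℝ)⁻¹ * ‖w‖ ^ 2) * F w))
          atTop := lintegral_liminf_le fun n => by fun_prop
    _ = ENNReal.ofReal (Φ 0).re := hlim''.liminf_eq
    _ < ⊤ := ENNReal.ofReal_lt_top

/-- A continuous integrable function with value `1` at `0` and non-negative Fourier transform is,
up to scaling, the characteristic function of a probability measure. -/
lemma exists_charFun_eq_of_fourier_nonneg {Φ : E → ℂ} (hc : Continuous Φ) (hi : Integrable Φ)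
    (h1 : Φ 0 = 1) {F : E → ℝ} (hF0 : ∀ w, 0 ≤ F w) (hF : ∀ w, 𝓕 Φ w = F w) :
    ∃ μ : Measure E, IsProbabilityMeasure μ ∧ ∀ t, charFun μ ((2 * Real.pi) • t) = Φ t := by
  have hFi := integrable_fourier_of_nonneg hc hi hF0 hF
  have hΦF : 𝓕 Φ = fun w => (F w : ℂ) := funext hF
  have hinv : 𝓕⁻ (𝓕 Φ) = Φ := hc.fourierInv_fourier_eq hi (by rw [hΦF]; exact hFi.ofReal)
  let μ : Measure E := volume.withDensity fun w => ENNReal.ofReal (F w)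
  have hfin : IsFiniteMeasure μ := isFiniteMeasure_withDensity_ofReal hFi.2
  have hchar : ∀ t, charFun μ ((2 * Real.pi) • t) = Φ t := by
    intro t
    rw [← congrFun hinv t, Real.fourierInv_eq', charFun_apply, hΦF,
      integral_withDensity_eq_integral_toReal_smul₀ hFi.1.aemeasurable.ennreal_ofReal (by simp)]
    refine integral_congr_ae (ae_of_all _ fun w => ?_)
    simp only [ENNReal.toReal_ofReal (hF0 w), inner_smul_right, smul_eq_mul, Complex.real_smul]
    push_cast
    ring
  refine ⟨μ, ⟨?_⟩, hchar⟩
  have h0 := hchar 0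
  rw [smul_zero, charFun_zero, h1] at h0
  rw [← ENNReal.toReal_eq_one_iff]
  exact_mod_cast h0

variable {H : Type*} [NormedAddCommGroup H] [InnerProductSpace ℝ H] [CompleteSpace H]
  [RKHS ℝ H E ℝ] {ψ : E → ℝ}

/-- Positivity comes from the squared norms in H of ∫ f₁(x) k(·,x) dx and ∫ f₂(x) k(·,x) dx. Their
sum is ∬ g(x) g(y) ψ(x-y) cos⟨x-y,w⟩; after u = x - y the Gaussian product separates, leaving the
desired integral times a positive constant. -/
lemma integral_kernel_mul_exp_mul_cos_nonneg (hH : IsRKHSOfKernel H fun x y => ψ (x - y))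
    (hψ : Continuous ψ) {b : ℝ} (hb : 0 < b) (w : E) :
    0 ≤ ∫ u, ψ u * Real.exp (-b * ‖u‖ ^ 2) * Real.cos ⟪u, w⟫ := by
  let g : E → ℝ := fun x => Real.exp (-(2 * b) * ‖x‖ ^ 2)
  have hg : Integrable g := integrable_exp_neg_mul_norm_sq (by positivity)
  let f₁ : E → ℝ := fun x => g x * Real.cos ⟪x, w⟫
  let f₂ : E → ℝ := fun x => g x * Real.sin ⟪x, w⟫
  have hf₁ : Integrable f₁ := hg.mul_bdd (c := 1) (by fun_prop)
    (ae_of_all _ fun x => Real.abs_cos_le_one _)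
  have hf₂ : Integrable f₂ := hg.mul_bdd (c := 1) (by fun_prop)
    (ae_of_all _ fun x => Real.abs_sin_le_one _)
  have hint : Integrable (fun p : E × E => f₁ p.1 * f₁ p.2 * ψ (p.1 - p.2) +
      f₂ p.1 * f₂ p.2 * ψ (p.1 - p.2)) (volume.prod volume) :=
    (integrable_prod_mul_kernel hH hψ hf₁ hf₁).add
    (integrable_prod_mul_kernel hH hψ hf₂ hf₂)
  have hsum : 0 ≤ ∫ p : E × E, (f₁ p.1 * f₁ p.2 * ψ (p.1 - p.2) +
      f₂ p.1 * f₂ p.2 * ψ (p.1 - p.2)) := by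
    rw [Measure.volume_eq_prod, integral_add (integrable_prod_mul_kernel hH hψ hf₁ hf₁)
      (integrable_prod_mul_kernel hH hψ hf₂ hf₂), ← inner_integral_smul_kerFun hH hψ hf₁ hf₁,
      ← inner_integral_smul_kerFun hH hψ hf₂ hf₂]
    exact add_nonneg real_inner_self_nonneg real_inner_self_nonneg
  have htrig : ∀ x y : E, f₁ x * f₁ y * ψ (x - y) + f₂ x * f₂ y * ψ (x - y) =
      g x * g y * (ψ (x - y) * Real.cos ⟪x - y, w⟫) := by
    intro x y
    simp only [f₁, f₂, inner_sub_left, Real.cos_sub]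
    ring
  -- Completing the square about u/2; the rate 2b in g is chosen to leave exactly the rate b in u.
  have hgg : ∀ x u : E, g x * g (x - u) = Real.exp (-b * ‖u‖ ^ 2) *
      Real.exp (-(4 * b) * ‖x - (1 / 2 : ℝ) • u‖ ^ 2) := by
    intro x u
    simp only [g, ← Real.exp_add]
    congr 1
    rw [norm_sub_sq_real, norm_sub_sq_real, inner_smul_right, norm_smul, mul_pow]
    norm_num
    ring
  have hI : ∀ u : E, ∫ x : E, Real.exp (-(4 * b) * ‖x - (1 / 2 : ℝ) • u‖ ^ 2) =
      ∫ x : E, Real.exp (-(4 * b) * ‖x‖ ^ 2) := fun u =>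
    integral_sub_right_eq_self (fun x : E => Real.exp (-(4 * b) * ‖x‖ ^ 2)) _
  have hIpos : 0 < ∫ x : E, Real.exp (-(4 * b) * ‖x‖ ^ 2) :=
    integral_exp_pos (integrable_exp_neg_mul_norm_sq (by positivity))
  have hint2 : Integrable (Function.uncurry fun x u : E =>
      g x * g (x - u) * (ψ u * Real.cos ⟪u, w⟫)) (volume.prod volume) := by
    refine (((integrable_exp_neg_mul_norm_sq (E := E) hb).mul_prod
      (integrable_exp_neg_mul_norm_sq (E := E) (half_pos hb))).mul_const (ψ 0)).mono'
      (by fun_prop) (ae_of_all _ fun ⟨x, u⟩ => ?_)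
    have h1 : |ψ u * Real.cos ⟪u, w⟫| ≤ ψ 0 := by
      rw [abs_mul]
      have := mul_le_mul (abs_kernel_le hH u) (Real.abs_cos_le_one ⟪u, w⟫) (abs_nonneg _)
        ((abs_nonneg _).trans (abs_kernel_le hH u))
      simpa using this
    have h2 : g x * g (x - u) ≤ Real.exp (-b * ‖x‖ ^ 2) * Real.exp (-(b / 2) * ‖u‖ ^ 2) := by
      simp only [g, ← Real.exp_add]
      rw [Real.exp_le_exp]
      have h3 := parallelogram_law_with_norm ℝ x (x - u)
      rw [sub_sub_cancel] at h3
      nlinarith [sq_nonneg ‖x + (x - u)‖, sq_nonneg ‖x - u‖, sq_nonneg ‖x‖, sq_nonneg ‖u‖]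
    simp only [Function.uncurry, Real.norm_eq_abs]
    rw [abs_mul, abs_of_nonneg (by positivity)]
    exact mul_le_mul h2 h1 (abs_nonneg _) (by positivity)
  have hmain : ∫ p : E × E, (f₁ p.1 * f₁ p.2 * ψ (p.1 - p.2) +
      f₂ p.1 * f₂ p.2 * ψ (p.1 - p.2)) =
      (∫ x : E, Real.exp (-(4 * b) * ‖x‖ ^ 2)) *
        ∫ u, ψ u * Real.exp (-b * ‖u‖ ^ 2) * Real.cos ⟪u, w⟫ := by
    rw [Measure.volume_eq_prod, integral_prod _ hint]
    simp_rw [htrig]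
    calc _ = ∫ x : E, ∫ u : E, g x * g (x - u) * (ψ u * Real.cos ⟪u, w⟫) := by
          refine integral_congr_ae (ae_of_all _ fun x => ?_)
          simp only
          rw [← integral_sub_left_eq_self _ _ x]
          simp
      _ = ∫ u : E, ∫ x : E, g x * g (x - u) * (ψ u * Real.cos ⟪u, w⟫) :=
          integral_integral_swap hint2
      _ = _ := by
          rw [← integral_const_mul]
          refine integral_congr_ae (ae_of_all _ fun u => ?_)
          simp only
          rw [integral_mul_const]
          simp_rw [hgg]
          rw [integral_const_mul, hI]
          ring
  rw [hmain] at hsum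
  exact nonneg_of_mul_nonneg_right hsum hIpos

/-- The sine part vanishes because ψ is even. -/
lemma fourier_kernel_mul_exp (hH : IsRKHSOfKernel H fun x y => ψ (x - y))
    (hψ : Continuous ψ) {b : ℝ} (hb : 0 < b) (w : E) :
    𝓕 (fun u => ((ψ u * Real.exp (-b * ‖u‖ ^ 2) : ℝ) : ℂ)) w =
      ((∫ u, ψ u * Real.exp (-b * ‖u‖ ^ 2) * Real.cos ⟪u, (2 * Real.pi) • w⟫ : ℝ) : ℂ) := by
  have hint : Integrable (fun u => ψ u * Real.exp (-b * ‖u‖ ^ 2)) :=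
    (integrable_exp_neg_mul_norm_sq hb).bdd_mul (c := ψ 0) hψ.aestronglyMeasurable
      (ae_of_all _ fun _ => abs_kernel_le hH _)
  have hcos : Integrable (fun u => ψ u * Real.exp (-b * ‖u‖ ^ 2) *
      Real.cos ⟪u, (2 * Real.pi) • w⟫) :=
    hint.mul_bdd (c := 1) (by fun_prop) (ae_of_all _ fun x => Real.abs_cos_le_one _)
  have hsin : Integrable (fun u => ψ u * Real.exp (-b * ‖u‖ ^ 2) *
      Real.sin ⟪u, (2 * Real.pi) • w⟫) :=
    hint.mul_bdd (c := 1) (by fun_prop) (ae_of_all _ fun x => Real.abs_sin_le_one _)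
  have hodd : ∫ u, ψ u * Real.exp (-b * ‖u‖ ^ 2) * Real.sin ⟪u, (2 * Real.pi) • w⟫ = 0 := by
    have h := integral_neg_eq_self (fun u => ψ u * Real.exp (-b * ‖u‖ ^ 2) *
      Real.sin ⟪u, (2 * Real.pi) • w⟫) volume
    simp only [kernel_neg hH, norm_neg, inner_neg_left, Real.sin_neg, mul_neg] at h
    rw [integral_neg] at h
    linarith
  rw [Real.fourier_eq']
  calc _ = ∫ u, (((ψ u * Real.exp (-b * ‖u‖ ^ 2) * Real.cos ⟪u, (2 * Real.pi) • w⟫ : ℝ) : ℂ) -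
        Complex.I * ((ψ u * Real.exp (-b * ‖u‖ ^ 2) *
          Real.sin ⟪u, (2 * Real.pi) • w⟫ : ℝ) : ℂ)) := by
        refine integral_congr_ae (ae_of_all _ fun u => ?_)
        simp only [inner_smul_right, smul_eq_mul]
        rw [neg_mul, neg_mul, Complex.ofReal_neg, Complex.exp_mul_I]
        push_cast
        rw [Complex.cos_neg, Complex.sin_neg]
        ring
    _ = _ := by
        rw [integral_sub hcos.ofReal (hsin.ofReal.const_mul _), integral_const_mul,
          integral_complex_ofReal, integral_complex_ofReal, hodd]
        simp

/-- **Bochner's theorem** for the translation-invariant kernel of a reproducing kernel Hilbert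
space. -/
theorem exists_charFun_eq_kernel (hH : IsRKHSOfKernel H fun x y => ψ (x - y))
    (hψ : Continuous ψ) :
    ∃ μ : Measure E, IsFiniteMeasure μ ∧ ∀ t, charFun μ t = ψ t := by
  rcases eq_or_ne (ψ 0) 0 with h0 | h0
  · refine ⟨0, inferInstance, fun t => ?_⟩
    have : ψ t = 0 := abs_nonpos_iff.mp (h0 ▸ abs_kernel_le hH t)
    simp [this]
  have hpos : 0 < ψ 0 := lt_of_le_of_ne ((abs_nonneg _).trans (abs_kernel_le hH 0)) h0.symm
  have hstep : ∀ n : ℕ, ∃ μ : Measure E, IsProbabilityMeasure μ ∧ ∀ t,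
      charFun μ ((2 * Real.pi) • t) =
        ((ψ t * Real.exp (-(1 / ((n : ℝ) + 1)) * ‖t‖ ^ 2) : ℝ) : ℂ) * ((ψ 0)⁻¹ : ℝ) := by
    intro n
    have hb : 0 < 1 / ((n : ℝ) + 1) := by positivity
    have hint : Integrable (fun u => ψ u * Real.exp (-(1 / ((n : ℝ) + 1)) * ‖u‖ ^ 2)) :=
      (integrable_exp_neg_mul_norm_sq hb).bdd_mul (c := ψ 0) hψ.aestronglyMeasurable
        (ae_of_all _ fun _ => abs_kernel_le hH _)
    refine exists_charFun_eq_of_fourier_nonneg (by fun_prop) (hint.ofReal.mul_const _)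
      (by simp [h0]) (F := fun w => (∫ u, ψ u * Real.exp (-(1 / ((n : ℝ) + 1)) * ‖u‖ ^ 2) *
        Real.cos ⟪u, (2 * Real.pi) • w⟫) * (ψ 0)⁻¹) (fun w => mul_nonneg
        (integral_kernel_mul_exp_mul_cos_nonneg hH hψ hb _) (by positivity)) (fun w => ?_)
    rw [Complex.ofReal_mul, ← fourier_kernel_mul_exp hH hψ hb, Real.fourier_eq',
      Real.fourier_eq', ← integral_mul_const]
    simp only [smul_eq_mul, mul_assoc]
  choose μ hμ hchar using hstep
  have h2π : (2 * Real.pi) ≠ 0 := by positivity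
  obtain ⟨ν, hν, hνc⟩ := exists_charFun_eq_of_tendsto (μ := μ)
    (φ := fun t => (ψ ((2 * Real.pi)⁻¹ • t) : ℂ) * ((ψ 0)⁻¹ : ℝ)) (by fun_prop) (fun t => by
      have h1 : ∀ n, charFun (μ n) t = ((ψ ((2 * Real.pi)⁻¹ • t) *
          Real.exp (-(1 / ((n : ℝ) + 1)) * ‖(2 * Real.pi)⁻¹ • t‖ ^ 2) : ℝ) : ℂ) *
            ((ψ 0)⁻¹ : ℝ) := by
        intro n; rw [← hchar, smul_inv_smul₀ h2π]
      simp_rw [h1]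
      have h2 : Continuous fun r : ℝ => ((ψ ((2 * Real.pi)⁻¹ • t) *
          Real.exp (-r * ‖(2 * Real.pi)⁻¹ • t‖ ^ 2) : ℝ) : ℂ) * ((ψ 0)⁻¹ : ℝ) := by fun_prop
      have h3 := (h2.tendsto 0).comp (tendsto_one_div_add_atTop_nhds_zero_nat (𝕜 := ℝ))
      simpa [Function.comp_def] using h3)
  -- This undoes the normalisation by ψ 0 and the factor 2π between the Fourier transform and
  -- `charFun`.
  refine ⟨(ψ 0).toNNReal • ν.map (fun x => (2 * Real.pi) • x), inferInstance, fun t => ?_⟩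
  have : charFun ((ψ 0).toNNReal • ν.map (fun x => (2 * Real.pi) • x)) t =
      (ψ 0 : ℂ) * charFun (ν.map (fun x => (2 * Real.pi) • x)) t := by
    rw [charFun_apply, charFun_apply, integral_smul_nnreal_measure]
    simp [NNReal.smul_def, hpos.le]
  rw [this, charFun_map_smul, hνc, inv_smul_smul₀ h2π]
  have h0' : (ψ 0 : ℂ) ≠ 0 := by exact_mod_cast h0
  push_cast
  field_simp

end Bochner

/-! ### The curvature integral near the origin. -/

section Curvature

variable {E : Type*} [NormedAddCommGroup E] [InnerProductSpace ℝ E]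

/-- Since t exp(-t) ≤ 1, the Gaussian weight absorbs the quadratic growth, and a constant dominates:
Λ needs no second moment. -/
lemma exp_neg_norm_sq_mul_inner_sq_le (a w : E) :
    Real.exp (-1 * ‖w‖ ^ 2) * ⟪a, w⟫ ^ 2 ≤ ‖a‖ ^ 2 := by
  have h1 : ⟪a, w⟫ ^ 2 ≤ ‖a‖ ^ 2 * ‖w‖ ^ 2 := by
    rw [← mul_pow, ← sq_abs]
    gcongr
    exact abs_real_inner_le_norm a w
  have h2 : Real.exp (-1 * ‖w‖ ^ 2) * ‖w‖ ^ 2 ≤ 1 := by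
    have h3 := Real.add_one_le_exp (‖w‖ ^ 2)
    rw [neg_one_mul, Real.exp_neg, inv_mul_le_one₀ (Real.exp_pos _)]
    linarith
  calc _ ≤ Real.exp (-1 * ‖w‖ ^ 2) * (‖a‖ ^ 2 * ‖w‖ ^ 2) := by gcongr
    _ = ‖a‖ ^ 2 * (Real.exp (-1 * ‖w‖ ^ 2) * ‖w‖ ^ 2) := by ring
    _ ≤ ‖a‖ ^ 2 * 1 := by gcongr
    _ = _ := mul_one _

lemma abs_exp_neg_norm_sq_mul_inner_sq_mul_cos_le (a w : E) (r : ℝ) :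
    |Real.exp (-1 * ‖w‖ ^ 2) * ⟪a, w⟫ ^ 2 * Real.cos r| ≤ ‖a‖ ^ 2 := by
  rw [abs_mul, abs_of_nonneg (by positivity)]
  calc _ ≤ Real.exp (-1 * ‖w‖ ^ 2) * ⟪a, w⟫ ^ 2 * 1 := by
        gcongr; exact Real.abs_cos_le_one r
    _ ≤ _ := by rw [mul_one]; exact exp_neg_norm_sq_mul_inner_sq_le a w

/-- Taylor's formula with integral remainder, which brings in the cosine at the intermediate points
s x. -/
lemma one_sub_cos_eq_integral (x : ℝ) :
    1 - Real.cos x = ∫ s in (0 : ℝ)..1, (1 - s) * (x ^ 2 * Real.cos (s * x)) := by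
  have hd : ∀ s ∈ Set.uIcc (0 : ℝ) 1, HasDerivAt
      (fun s : ℝ => (1 - s) * (x * Real.sin (s * x)) - Real.cos (s * x))
      ((1 - s) * (x ^ 2 * Real.cos (s * x))) s := by
    intro s _
    have h1 : HasDerivAt (fun s : ℝ => s * x) x s := by simpa using (hasDerivAt_id s).mul_const x
    have h2 : HasDerivAt (fun s : ℝ => 1 - s) (-1) s := (hasDerivAt_id s).const_sub 1
    convert! (h2.mul (h1.sin.const_mul x)).sub h1.cos using 1
    ring
  rw [intervalIntegral.integral_eq_sub_of_hasDerivAt hd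
    (Continuous.intervalIntegrable (by fun_prop) _ _)]
  simp only [sub_self, zero_mul, one_mul, Real.cos_zero, Real.sin_zero, mul_zero]
  ring

variable [FiniteDimensional ℝ E] [MeasurableSpace E] [BorelSpace E]

lemma continuous_integral_exp_mul_inner_sq_mul_cos (Λ : Measure E) [IsFiniteMeasure Λ] :
    Continuous fun p : E × Metric.sphere (0 : E) 1 =>
      ∫ w, Real.exp (-1 * ‖w‖ ^ 2) * ⟪(p.2 : E), w⟫ ^ 2 * Real.cos ⟪p.1, w⟫ ∂Λ := by
  refine continuous_of_dominated (bound := fun _ => 1) (fun p => by fun_prop)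
    (fun p => ae_of_all _ fun w => ?_) (integrable_const _) (ae_of_all _ fun w => by fun_prop)
  have h := abs_exp_neg_norm_sq_mul_inner_sq_mul_cos_le (p.2 : E) w ⟪p.1, w⟫
  simpa using h

/-- If `Λ` is not carried by any hyperplane, the curvature integral is bounded below near the
origin, uniformly in the direction. -/
lemma exists_le_integral_exp_mul_inner_sq_mul_cos (Λ : Measure E) [IsFiniteMeasure Λ]
    (hΛ : ∀ e : E, ‖e‖ = 1 → ¬ ∀ᵐ w ∂Λ, ⟪e, w⟫ = 0) :
    ∃ c ε : ℝ, 0 < c ∧ 0 < ε ∧ ∀ a : E, ‖a‖ ^ 2 ≤ ε → ∀ e : E, ‖e‖ = 1 →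
      c ≤ ∫ w, Real.exp (-1 * ‖w‖ ^ 2) * ⟪e, w⟫ ^ 2 * Real.cos ⟪a, w⟫ ∂Λ := by
  set G := fun p : E × Metric.sphere (0 : E) 1 =>
      ∫ w, Real.exp (-1 * ‖w‖ ^ 2) * ⟪(p.2 : E), w⟫ ^ 2 * Real.cos ⟪p.1, w⟫ ∂Λ with hG
  have hGc : Continuous G := continuous_integral_exp_mul_inner_sq_mul_cos Λ
  have hpos : ∀ e, 0 < G (0, e) := by
    intro e
    have hnn : ∀ w, 0 ≤ Real.exp (-1 * ‖w‖ ^ 2) * ⟪(e : E), w⟫ ^ 2 * Real.cos ⟪(0 : E), w⟫ := by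
      intro w; simp only [inner_zero_left, Real.cos_zero]; positivity
    have hint : Integrable (fun w => Real.exp (-1 * ‖w‖ ^ 2) * ⟪(e : E), w⟫ ^ 2 *
        Real.cos ⟪(0 : E), w⟫) Λ :=
      (integrable_const (‖(e : E)‖ ^ 2)).mono' (by fun_prop) (ae_of_all _ fun w =>
        abs_exp_neg_norm_sq_mul_inner_sq_mul_cos_le _ _ _)
    refine lt_of_le_of_ne (integral_nonneg hnn) fun h0 => ?_
    refine hΛ e (by simp) ?_
    have h1 := (integral_eq_zero_iff_of_nonneg hnn hint).mp h0.symm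
    filter_upwards [h1] with w hw
    simpa [Real.exp_ne_zero] using hw
  obtain ⟨c, hc, hcG⟩ : ∃ c, 0 < c ∧ ∀ e, c < G (0, e) := by
    rcases isEmpty_or_nonempty (Metric.sphere (0 : E) 1) with hemp | hne
    · exact ⟨1, one_pos, fun e => hemp.elim e⟩
    · obtain ⟨e₀, -, he₀⟩ := isCompact_univ.exists_isMinOn Set.univ_nonempty
        (f := fun e => G (0, e)) (by fun_prop)
      refine ⟨G (0, e₀) / 2, half_pos (hpos _), fun e => ?_⟩
      exact (half_lt_self (hpos _)).trans_le (he₀ (Set.mem_univ e))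
  have hopen : IsOpen {p | c < G p} := isOpen_lt continuous_const hGc
  -- The strict bound at a = 0 holds on the whole compact sphere, so it persists on a neighbourhood
  -- of 0 independent of e.
  obtain ⟨U, V, hU, -, h0U, hV, hUV⟩ := generalized_tube_lemma (isCompact_singleton (x := (0 : E)))
    (isCompact_univ (X := Metric.sphere (0 : E) 1)) hopen (by
      rintro ⟨a, e⟩ ⟨ha, -⟩
      obtain rfl : a = 0 := ha
      exact hcG e)
  obtain ⟨r, hr, hrU⟩ := Metric.isOpen_iff.mp hU 0 (h0U rfl)
  refine ⟨c, (r / 2) ^ 2, hc, by positivity, fun a ha e he => ?_⟩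
  have ha' : ‖a‖ ≤ r / 2 := abs_le_of_sq_le_sq' ha (by positivity) |>.2
  have hmem : (a, (⟨e, by simpa using he⟩ : Metric.sphere (0 : E) 1)) ∈ {p | c < G p} :=
    hUV ⟨hrU (by simp; linarith), hV (Set.mem_univ _)⟩
  exact le_of_lt hmem

/-- The hypothesis is applied at s a in the direction a/‖a‖ for every s in (0, 1], then integrated
against the Taylor weight 1 - s, whose total mass is 1/2. -/
lemma le_integral_exp_mul_one_sub_cos (Λ : Measure E) [IsFiniteMeasure Λ] {c ε : ℝ}
    (h : ∀ a : E, ‖a‖ ^ 2 ≤ ε → ∀ e : E, ‖e‖ = 1 →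
      c ≤ ∫ w, Real.exp (-1 * ‖w‖ ^ 2) * ⟪e, w⟫ ^ 2 * Real.cos ⟪a, w⟫ ∂Λ)
    {a : E} (ha : ‖a‖ ^ 2 ≤ ε) :
    c * ‖a‖ ^ 2 / 2 ≤ ∫ w, Real.exp (-1 * ‖w‖ ^ 2) * (1 - Real.cos ⟪a, w⟫) ∂Λ := by
  rcases eq_or_ne a 0 with rfl | ha0
  · simp
  have hJ : ∀ s ∈ Set.Ioc (0 : ℝ) 1, c * ‖a‖ ^ 2 ≤
      ∫ w, Real.exp (-1 * ‖w‖ ^ 2) * ⟪a, w⟫ ^ 2 * Real.cos (s * ⟪a, w⟫) ∂Λ := by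
    intro s hs
    have h1 := h (s • a) (by
      rw [norm_smul, mul_pow]
      refine le_trans ?_ ha
      refine mul_le_of_le_one_left (by positivity) ?_
      rw [Real.norm_eq_abs, sq_abs]
      exact pow_le_one₀ hs.1.le hs.2) (‖a‖⁻¹ • a) (by
        rw [norm_smul, norm_inv, norm_norm, inv_mul_cancel₀ (norm_ne_zero_iff.mpr ha0)])
    have hn : ‖a‖ ^ 2 ≠ 0 := by simpa using ha0
    calc c * ‖a‖ ^ 2 ≤ (∫ w, Real.exp (-1 * ‖w‖ ^ 2) * ⟪‖a‖⁻¹ • a, w⟫ ^ 2 *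
          Real.cos ⟪s • a, w⟫ ∂Λ) * ‖a‖ ^ 2 := by gcongr
      _ = _ := by
        rw [← integral_mul_const]
        refine integral_congr_ae (ae_of_all _ fun w => ?_)
        simp only [real_inner_smul_left, mul_pow, inv_pow]
        field_simp
  have hint : Integrable (Function.uncurry fun (w : E) (s : ℝ) =>
      (1 - s) * (Real.exp (-1 * ‖w‖ ^ 2) * ⟪a, w⟫ ^ 2 * Real.cos (s * ⟪a, w⟫)))
      (Λ.prod (volume.restrict (Set.Ioc (0 : ℝ) 1))) := by
    have h1 : Integrable (fun p : E × ℝ => (1 - p.2 : ℝ))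
        (Λ.prod (volume.restrict (Set.Ioc (0 : ℝ) 1))) := by
      have : Integrable (fun s : ℝ => 1 - s) (volume.restrict (Set.Ioc (0 : ℝ) 1)) :=
        (Continuous.integrableOn_Ioc (by fun_prop))
      exact this.comp_snd Λ
    exact h1.mul_bdd (c := ‖a‖ ^ 2) (by fun_prop) (ae_of_all _ fun p =>
      abs_exp_neg_norm_sq_mul_inner_sq_mul_cos_le _ _ _)
  have hswap : ∫ w, Real.exp (-1 * ‖w‖ ^ 2) * (1 - Real.cos ⟪a, w⟫) ∂Λ =
      ∫ s in Set.Ioc (0 : ℝ) 1, (1 - s) *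
        ∫ w, Real.exp (-1 * ‖w‖ ^ 2) * ⟪a, w⟫ ^ 2 * Real.cos (s * ⟪a, w⟫) ∂Λ := by
    simp_rw [← integral_const_mul]
    rw [← integral_integral_swap hint]
    refine integral_congr_ae (ae_of_all _ fun w => ?_)
    simp only
    rw [one_sub_cos_eq_integral, intervalIntegral.integral_of_le zero_le_one,
      ← integral_const_mul]
    refine integral_congr_ae (ae_of_all _ fun s => ?_)
    simp only
    ring
  have hr := hint.integral_prod_right
  simp only [Function.uncurry, integral_const_mul] at hr
  rw [hswap]
  have hl : IntegrableOn (fun s : ℝ => (1 - s) * (c * ‖a‖ ^ 2)) (Set.Ioc 0 1) :=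
    Continuous.integrableOn_Ioc (by fun_prop)
  calc c * ‖a‖ ^ 2 / 2 = ∫ s in Set.Ioc (0 : ℝ) 1, (1 - s) * (c * ‖a‖ ^ 2) := by
        rw [integral_mul_const, ← intervalIntegral.integral_of_le zero_le_one,
          intervalIntegral.integral_sub (by simp) (by simp)]
        simp
        ring
    _ ≤ _ := setIntegral_mono_on hl hr measurableSet_Ioc fun s hs =>
        mul_le_mul_of_nonneg_left (hJ s hs) (by linarith [hs.2])

end Curvature

/-! ### Characteristic kernels and embeddings of Gaussians. -/

section MeanEmbedding

variable {E : Type*} [NormedAddCommGroup E] [InnerProductSpace ℝ E] [FiniteDimensional ℝ E]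
  [MeasurableSpace E] [BorelSpace E]
  {H : Type*} [NormedAddCommGroup H] [InnerProductSpace ℝ H] [CompleteSpace H]
  [RKHS ℝ H E ℝ] {ψ : E → ℝ}

lemma kernelMean_dirac (x : E) : kernelMean H (Measure.dirac x) = RKHS.kerFun H x (1 : ℝ) :=
  integral_dirac _ _

lemma eq_zero_of_kernel_eq (hH : IsRKHSOfKernel H fun x y => ψ (x - y))
    (hchar : IsCharacteristicRKHS H) {e : E} (he : ψ e = ψ 0) : e = 0 := by
  have h1 := norm_kerFun_sub_sq hH e 0
  rw [sub_zero, he, sub_self, sq_eq_zero_iff, norm_eq_zero, sub_eq_zero] at h1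
  refine dirac_eq_dirac_iff.mp (hchar (Measure.dirac.isProbabilityMeasure)
    (Measure.dirac.isProbabilityMeasure) ?_)
  simp only [kernelMean_dirac, h1]

lemma not_ae_inner_eq_zero (hH : IsRKHSOfKernel H fun x y => ψ (x - y))
    (hchar : IsCharacteristicRKHS H) {Λ : Measure E} {C : ℝ}
    (hΛ : ∀ x, (ψ x : ℂ) = C * ∫ w, Complex.exp (-Complex.I * ((⟪x, w⟫ : ℝ) : ℂ)) ∂Λ)
    {e : E} (he : e ≠ 0) : ¬ ∀ᵐ w ∂Λ, ⟪e, w⟫ = 0 := by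
  intro h
  refine he (eq_zero_of_kernel_eq hH hchar ?_)
  have : (ψ e : ℂ) = ψ 0 := by
    rw [hΛ, hΛ]
    congr 1
    refine integral_congr_ae ?_
    filter_upwards [h] with w hw
    simp [hw]
  exact_mod_cast this

lemma integrable_exp_neg_norm_sq_mul_cos (Λ : Measure E) [IsFiniteMeasure Λ] (a : E) :
    Integrable (fun w => Real.exp (-1 * ‖w‖ ^ 2) * Real.cos ⟪a, w⟫) Λ := by
  refine (integrable_const (1 : ℝ)).mono' (by fun_prop) (ae_of_all _ fun w => ?_)
  rw [Real.norm_eq_abs, abs_mul, Real.abs_exp]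
  exact mul_le_one₀ (Real.exp_le_one_iff.mpr (by nlinarith [sq_nonneg ‖w‖])) (abs_nonneg _)
    (Real.abs_cos_le_one _)

/-- Each characteristic function contributes exp(-‖w‖²/2), whence the weight exp(-‖w‖²) in (*). -/
lemma inner_kernelMean_gaussianShift (hH : IsRKHSOfKernel H fun x y => ψ (x - y))
    (hψ : Continuous ψ) (Λ : Measure E) [IsFiniteMeasure Λ] {C : ℝ}
    (hΛ : ∀ x, (ψ x : ℂ) = C * ∫ w, Complex.exp (-Complex.I * ((⟪x, w⟫ : ℝ) : ℂ)) ∂Λ) (a b : E) :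
    ⟪kernelMean H (gaussianShift b), kernelMean H (gaussianShift a)⟫ =
      C * ∫ w, Real.exp (-1 * ‖w‖ ^ 2) * Real.cos ⟪a - b, w⟫ ∂Λ := by
  have h := ofReal_inner_kernelMean hH hψ (gaussianShift b) (gaussianShift a) Λ hΛ
  have hprod : ∀ w, charFun (gaussianShift b) (-w) * charFun (gaussianShift a) w =
      (Real.exp (-1 * ‖w‖ ^ 2) : ℂ) * Complex.exp ((⟪a - b, w⟫ : ℝ) * Complex.I) := by
    intro w
    rw [charFun_gaussianShift, charFun_gaussianShift, Complex.ofReal_exp, ← Complex.exp_add,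
      ← Complex.exp_add, inner_neg_right, inner_sub_left, norm_neg]
    congr 1
    push_cast
    ring
  have hint : Integrable (fun w => (Real.exp (-1 * ‖w‖ ^ 2) : ℂ) *
      Complex.exp ((⟪a - b, w⟫ : ℝ) * Complex.I)) Λ := by
    refine (integrable_const (1 : ℝ)).mono' (by fun_prop) (ae_of_all _ fun w => ?_)
    rw [norm_mul, Complex.norm_exp_ofReal_mul_I, mul_one, Complex.norm_real, Real.norm_eq_abs,
      Real.abs_exp]
    exact Real.exp_le_one_iff.mpr (by nlinarith [sq_nonneg ‖w‖])
  simp_rw [hprod] at h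
  have h2 := congrArg Complex.re h
  rw [Complex.ofReal_re, Complex.re_ofReal_mul] at h2
  have h3 := integral_re hint
  simp only [RCLike.re_eq_complex_re, Complex.re_ofReal_mul, Complex.exp_ofReal_mul_I_re] at h3
  rw [h2, ← h3]

lemma norm_kernelMean_gaussianShift_sub_sq (hH : IsRKHSOfKernel H fun x y => ψ (x - y))
    (hψ : Continuous ψ) (Λ : Measure E) [IsFiniteMeasure Λ] {C : ℝ}
    (hΛ : ∀ x, (ψ x : ℂ) = C * ∫ w, Complex.exp (-Complex.I * ((⟪x, w⟫ : ℝ) : ℂ)) ∂Λ) (a : E) :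
    ‖kernelMean H (gaussianShift (0 : E)) - kernelMean H (gaussianShift a)‖ ^ 2 =
      2 * C * ∫ w, Real.exp (-1 * ‖w‖ ^ 2) * (1 - Real.cos ⟪a, w⟫) ∂Λ := by
  have h0 := integrable_exp_neg_norm_sq_mul_cos Λ (0 : E)
  simp only [inner_zero_left, Real.cos_zero, mul_one] at h0
  rw [norm_sub_sq_real, ← real_inner_self_eq_norm_sq, ← real_inner_self_eq_norm_sq,
    inner_kernelMean_gaussianShift hH hψ Λ hΛ, inner_kernelMean_gaussianShift hH hψ Λ hΛ,
    inner_kernelMean_gaussianShift hH hψ Λ hΛ]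
  simp_rw [mul_sub, mul_one]
  rw [integral_sub h0 (integrable_exp_neg_norm_sq_mul_cos Λ a)]
  simp only [sub_self, sub_zero, inner_zero_left, Real.cos_zero, mul_one]
  ring

end MeanEmbedding

/-! ### Reduction from estimation to testing. -/

section Minimax

lemma quarter_le_minimaxProbability {X H : Type*} [MeasurableSpace X] [NormedAddCommGroup H]
    [InnerProductSpace ℝ H] [CompleteSpace H] [RKHS ℝ H X ℝ] {Ps : Set (Measure X)} {n : ℕ}
    {s : ℝ} {P Q : Measure X} (hP : P ∈ Ps) (hQ : Q ∈ Ps)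
    (hsep : 2 * s ≤ ‖kernelMean H P - kernelMean H Q‖)
    (htest : ∀ A B : Set (Fin n → X), A ∪ B = Set.univ →
      1 / 2 ≤ Measure.pi (fun _ => P) A + Measure.pi (fun _ => Q) B) :
    1 / 4 ≤ minimaxProbability H Ps n s := by
  refine le_iInf fun θ => ?_
  -- By the triangle inequality an estimate cannot lie within s of both embeddings, so the two error
  -- events cover the sample space.
  have h := htest {x | s ≤ ‖θ x - kernelMean H P‖} {x | s ≤ ‖θ x - kernelMean H Q‖} (by
    refine Set.eq_univ_of_forall fun x => ?_
    by_contra hx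
    simp only [Set.mem_union, Set.mem_ofPred_eq, not_or, not_le] at hx
    have := norm_sub_le_norm_sub_add_norm_sub (kernelMean H P) (θ x) (kernelMean H Q)
    rw [norm_sub_rev (kernelMean H P) (θ x)] at this
    linarith [hx.1, hx.2])
  set S := ⨆ P ∈ Ps, Measure.pi (fun _ : Fin n => P) {x | s ≤ ‖θ x - kernelMean H P‖}
  have hPS : Measure.pi (fun _ : Fin n => P) {x | s ≤ ‖θ x - kernelMean H P‖} ≤ S :=
    le_iSup₂ (f := fun (P : Measure X) (_ : P ∈ Ps) =>
      Measure.pi (fun _ : Fin n => P) {x | s ≤ ‖θ x - kernelMean H P‖}) P hP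
  have hQS : Measure.pi (fun _ : Fin n => Q) {x | s ≤ ‖θ x - kernelMean H Q‖} ≤ S :=
    le_iSup₂ (f := fun (P : Measure X) (_ : P ∈ Ps) =>
      Measure.pi (fun _ : Fin n => P) {x | s ≤ ‖θ x - kernelMean H P‖}) Q hQ
  have h2 : 1 / 2 ≤ 2 * S := by
    rw [two_mul]
    exact h.trans (add_le_add hPS hQS)
  rcases eq_or_ne S ⊤ with hT | hT
  · rw [hT]; exact le_top
  · clear_value S
    lift S to NNReal using hT
    have h3 : (1 / 2 : NNReal) ≤ 2 * S := by
      rw [← ENNReal.coe_le_coe]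
      simpa using h2
    have h4 : (1 / 4 : NNReal) ≤ S := by
      rw [← NNReal.coe_le_coe] at h3 ⊢
      push_cast at h3 ⊢
      linarith
    rw [← ENNReal.coe_le_coe] at h4
    simpa using h4

lemma gaussianShift_mem_smoothDensityMeasures {d : ℕ} (a : EuclideanSpace ℝ (Fin d)) :
    gaussianShift a ∈ smoothDensityMeasures d :=
  ⟨inferInstance, gaussianShiftPDF a, contDiff_gaussianShiftPDF a, gaussianShiftPDF_nonneg a, rfl⟩

end Minimax

/-! ### Existence of Λ and the main theorem. -/

theorem exists_isBochnerMeasure {d : ℕ} {ψ : EuclideanSpace ℝ (Fin d) → ℝ}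
    (hcont : Continuous ψ)
    {H : Type*} [NormedAddCommGroup H] [InnerProductSpace ℝ H] [CompleteSpace H]
    [RKHS ℝ H (EuclideanSpace ℝ (Fin d)) ℝ]
    (hH : IsRKHSOfKernel H fun x y => ψ (x - y)) :
    ∃ Λ : Measure (EuclideanSpace ℝ (Fin d)), IsBochnerMeasure ψ Λ := by
  obtain ⟨μ, hμ, hchar⟩ := exists_charFun_eq_kernel hH hcont
  have hC : 0 < (2 * Real.pi) ^ (-((d : ℝ) / 2)) := by positivity
  refine ⟨((2 * Real.pi) ^ (-((d : ℝ) / 2)))⁻¹.toNNReal • μ, inferInstance, fun x => ?_⟩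
  have h1 : ∫ w, Complex.exp (-Complex.I * ((⟪x, w⟫ : ℝ) : ℂ)) ∂μ = ψ x := by
    rw [← kernel_neg hH x, ← hchar, charFun_apply]
    refine integral_congr_ae (ae_of_all _ fun w => ?_)
    simp only [inner_neg_right, real_inner_comm x w]
    push_cast
    ring_nf
  have hC' : (((2 * Real.pi) ^ (-((d : ℝ) / 2)) : ℝ) : ℂ) ≠ 0 := by exact_mod_cast hC.ne'
  rw [integral_smul_nnreal_measure, h1, NNReal.smul_def, Real.coe_toNNReal _ (by positivity),
    Complex.real_smul, Complex.ofReal_inv, mul_inv_cancel_left₀ hC']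

theorem theorem6 {d : ℕ} (hd : 1 ≤ d) (ψ : EuclideanSpace ℝ (Fin d) → ℝ)
    (hcont : Continuous ψ) (hbdd : ∃ M : ℝ, ∀ x, |ψ x| ≤ M) (hpd : IsPositiveDefinite ψ)
    {H : Type*} [NormedAddCommGroup H] [InnerProductSpace ℝ H] [CompleteSpace H]
    [RKHS ℝ H (EuclideanSpace ℝ (Fin d)) ℝ]
    (hH : IsRKHSOfKernel H fun x y => ψ (x - y))
    (hchar : IsCharacteristicRKHS H) :
    (∃ c ε : ℝ, IsCurvatureConstants ψ 1 c ε) ∧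
      ∀ c ε : ℝ, IsCurvatureConstants ψ 1 c ε → ∀ n : ℕ, 1 / ε ≤ (n : ℝ) →
        1 / 4 ≤ minimaxProbability H (smoothDensityMeasures d) n
          (1 / 2 * Real.sqrt (c / (2 * n))) := by
  set C : ℝ := (2 * Real.pi) ^ (-((d : ℝ) / 2)) with hC
  have hC0 : 0 < C := by positivity
  constructor
  · obtain ⟨Λ, hΛ⟩ := exists_isBochnerMeasure hcont hH
    have := hΛ.1
    obtain ⟨c, ε, hc, hε, h⟩ := exists_le_integral_exp_mul_inner_sq_mul_cos Λ fun e he =>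
      not_ae_inner_eq_zero hH hchar hΛ.2 (norm_ne_zero_iff.mp (he ▸ one_ne_zero))
    refine ⟨2 * C * c, ε, by positivity, hε, Λ, hΛ, fun a ha e he => ?_⟩
    exact mul_le_mul_of_nonneg_left (h a ha e he) (by positivity)
  · rintro c ε ⟨hc, hε, Λ, hΛ, h⟩ n hn
    have := hΛ.1
    have hn0 : (0 : ℝ) < n := (by positivity : 0 < 1 / ε).trans_le hn
    -- Only ‖a‖² = 1/n matters: it fixes the affinity, and n ≥ 1/ε puts a in the range of (*).
    let a : EuclideanSpace ℝ (Fin d) := EuclideanSpace.single ⟨0, hd⟩ (Real.sqrt n)⁻¹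
    have ha : ‖a‖ ^ 2 = 1 / n := by
      simp only [a, PiLp.norm_single, norm_inv, inv_pow, Real.norm_eq_abs, sq_abs]
      rw [Real.sq_sqrt hn0.le, one_div]
    refine quarter_le_minimaxProbability (gaussianShift_mem_smoothDensityMeasures 0)
      (gaussianShift_mem_smoothDensityMeasures a) ?_ fun A B hAB =>
        half_le_pi_gaussianShift_add (by rw [ha]; field_simp) hAB
    have haε : ‖a‖ ^ 2 ≤ ε := by
      rw [ha, one_div_le hn0 hε]; exact hn
    -- Dividing by 2C removes the prefactor of (*); the same 2C returns in the squared distance.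
    have hlow := le_integral_exp_mul_one_sub_cos Λ (c := c / (2 * C)) (ε := ε)
      (fun b hb e he => by
        rw [div_le_iff₀' (by positivity)]
        exact h b hb e he) haε
    have hnorm := norm_kernelMean_gaussianShift_sub_sq hH hcont Λ hΛ.2 a
    rw [← mul_assoc, show (2 : ℝ) * (1 / 2) = 1 by norm_num, one_mul]
    refine Real.sqrt_le_iff.mpr ⟨norm_nonneg _, ?_⟩
    rw [hnorm]
    calc c / (2 * n) = 2 * C * (c / (2 * C) * ‖a‖ ^ 2 / 2) := by rw [ha]; field_simp
      _ ≤ _ := mul_le_mul_of_nonneg_left hlow (by positivity)
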